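/- Let $f:\mathbb{R}\to\mathbb{R}$ be $1$-periodic with $f\in L^2[0,1]$. For $n\ge 0$ let $\mathcal{D}_n$ be the $\sigma$-algebra generated by the intervals $\left(\frac{k}{2^n},\frac{k+1}{2^n}\right]$, $0\le k\le 2^n-1$, and put $f_n=\mathbb{E}[f\mid\mathcal{D}_n]$ (with respect to Lebesgue measure on $[0,1]$) and $\varphi_n=f-f_n$. Assume that $\sum_{s\ge 1}\|\varphi_s\|_{2}<\infty$, where $\|\cdot\|_2$ is the norm of $L^2[0,1]$. (i) If $\int_0^1 f(x)\,dx=0$, then the finite limit $$\sigma^2=\lim_{n\to\infty}\left\|\frac{f(x)+f(2x)+\cdots+f(2^{n-1}x)}{\sqrt n}\right\|_2^2$$ exists. (ii) If this limit exists, is finite and is different from zero, then, with $\sigma>0$ its positive square root, for every $t\in\mathbb{R}$ $$\left|\left\{x\in[0,1]:\ \frac{f(x)+f(2x)+\cdots+f(2^{n-1}x)}{\sqrt n}\le t\right\}\right|\ \longrightarrow\ \frac{1}{\sigma\sqrt{2\pi}}\int_{-\infty}^t e^{-u^2/(2\sigma^2)}\,du\qquad(n\to\infty),$$ where $|\cdot|$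 is Lebesgue measure. -/

import Mathlib

open MeasureTheory Set Filter Topology

noncomputable section

/-- Lebesgue measure on the unit interval `[0, 1]`, as a measure on `ℝ`. -/
abbrev unitLebesgue : Measure ℝ := volume.restrict (Icc (0 : ℝ) 1)

/-- The dyadic `σ`-algebra of level `n`, generated by the intervals
`(k / 2 ^ n, (k + 1) / 2 ^ n]` with `0 ≤ k ≤ 2 ^ n - 1`. It is carried by `ℝ`; the complement of
`(0, 1]` is then an atom, which is null for `unitLebesgue`. -/
def dyadicSigma (n : ℕ) : MeasurableSpace ℝ :=
  MeasurableSpace.generateFrom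
    {s : Set ℝ | ∃ k : ℕ, k < 2 ^ n ∧ s = Ioc ((k : ℝ) / 2 ^ n) (((k : ℝ) + 1) / 2 ^ n)}

/-- The dyadic `σ`-algebras consist of Borel sets, so that conditional expectations given
them are the genuine ones. -/
theorem dyadicSigma_le (n : ℕ) : dyadicSigma n ≤ (inferInstance : MeasurableSpace ℝ) := by
  refine MeasurableSpace.generateFrom_le ?_
  rintro s ⟨k, -, rfl⟩
  exact measurableSet_Ioc

/-- `f_n = E[f | D_n]`, with respect to Lebesgue measure on `[0, 1]`. -/
def dyadicCondExp (f : ℝ → ℝ) (n : ℕ) : ℝ → ℝ :=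
  condExp (dyadicSigma n) unitLebesgue f

/-- `φ_n = f - f_n`. -/
def dyadicRemainder (f : ℝ → ℝ) (n : ℕ) : ℝ → ℝ :=
  fun x => f x - dyadicCondExp f n x

/-- The normalized sum `(f(x) + f(2x) + ⋯ + f(2 ^ (n - 1) x)) / √n`. -/
def normalizedSum (f : ℝ → ℝ) (n : ℕ) : ℝ → ℝ :=
  fun x => (∑ k ∈ Finset.range n, f (2 ^ k * x)) / Real.sqrt n

/-- The squared norm `‖(f(x) + f(2x) + ⋯ + f(2 ^ (n - 1) x)) / √n‖₂²` in `L²[0, 1]`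
(finite for a periodic `f` in `L²[0, 1]`). -/
def normalizedSqNorm (f : ℝ → ℝ) (n : ℕ) : ℝ :=
  (eLpNorm (normalizedSum f n) 2 unitLebesgue).toReal ^ 2

end

/-! ### Gordin decomposition and norms of orbit sums for a Hilbert space isometry -/

section HilbertIsometry

open ContinuousLinearMap

variable {H : Type*} [NormedAddCommGroup H] [InnerProductSpace ℝ H]

/-! On the circle, `f (2 ^ k * x)` is `U ^ k` applied to the class `F` of `f`, where `U` is the
Koopman isometry of the ergodic doubling map. Let `U*` be its adjoint and put `G = U*^k F`. Then
`‖G‖² = ⟨U^k G, F⟩`, and `U^k G` depends only on the digits after place `k`, hence is independent of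
`f_k`. If `f` has mean zero, `f_k` may be subtracted from `F`, and Cauchy-Schwarz gives `‖U*^k F‖ ≤
‖φ_k‖` (`norm_adjoint_koopman_circleDouble_pow_le`).

Summability now yields Gordin's decomposition `F = h + (U w - w)` with `U* h = 0`. The vectors `U^k
h` are orthogonal and of equal norm, while the coboundary sums stay bounded, so the limit in (i)
exists and `σ = ‖h‖`.

For (ii), convergence of the normalized norms already forces mean zero. The terms `U^k h` are
stationary reversed martingale differences. If `h` is replaced by a bounded `g` with `U* g = 0`,
McLeish's products have mean one and the ergodic theorem controls the empirical variance, which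
gives the CLT. Such `g` are dense in `ker U*`, and the error is uniform in `n`. Lévy continuity and
the portmanteau theorem finish. -/

theorem norm_pow_apply_of_norm_map {U : H →L[ℝ] H} (hU : ∀ x, ‖U x‖ = ‖x‖) (n : ℕ) (x : H) :
    ‖(U ^ n) x‖ = ‖x‖ := by
  induction n with
  | zero => simp
  | succ n ih => rw [pow_succ', mul_apply_eq_comp, hU, ih]

theorem sum_range_succ_pow_apply (U : H →L[ℝ] H) (n : ℕ) (h : H) :
    ∑ k ∈ Finset.range (n + 1), (U ^ k) h = h + U (∑ k ∈ Finset.range n, (U ^ k) h) := by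
  rw [Finset.sum_range_succ', map_sum, add_comm]
  simp [pow_succ']

variable [CompleteSpace H]

theorem adjoint_apply_apply_of_norm_map {U : H →L[ℝ] H} (hU : ∀ x, ‖U x‖ = ‖x‖) (x : H) :
    adjoint U (U x) = x := by
  have := (ContinuousLinearMap.norm_map_iff_adjoint_comp_self U).1 hU
  exact congrArg (fun V : H →L[ℝ] H => V x) this

/-- Gordin's decomposition: if the iterates of the adjoint of an isometry are summable at `x`, then
`x` is a coboundary plus a vector in the kernel of the adjoint. -/
theorem exists_eq_add_sub_of_summable_adjoint_pow {U : H →L[ℝ] H} (hU : ∀ x, ‖U x‖ = ‖x‖) {x : H}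
    (hx : Summable fun k : ℕ => ‖(adjoint U ^ k) x‖) :
    ∃ h w : H, adjoint U h = 0 ∧ x = h + (U w - w) := by
  have hs : Summable fun k : ℕ => (adjoint U ^ k) x := hx.of_norm
  set g := ∑' k : ℕ, (adjoint U ^ k) x with hg
  have h1 : g = x + adjoint U g := by
    rw [hg, ContinuousLinearMap.map_tsum _ hs, hs.tsum_eq_zero_add]
    simp [pow_succ']
  -- `g` solves `x = g - U* g`; inserting `U U* g` splits this into the part of `g` orthogonal to
  -- the range of `U` and a coboundary.
  refine ⟨g - U (adjoint U g), adjoint U g, ?_, ?_⟩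
  · rw [map_sub, adjoint_apply_apply_of_norm_map hU, sub_self]
  · rw [sub_add_sub_cancel]
    exact eq_sub_of_add_eq h1.symm

/-- The kernel of `U*` is orthogonal to the range of `U`, so Pythagoras applies to `S (n+1) = h + U
(S n)`. -/
theorem norm_sq_sum_pow_apply {U : H →L[ℝ] H} (hU : ∀ x, ‖U x‖ = ‖x‖) {h : H}
    (hh : adjoint U h = 0) (n : ℕ) :
    ‖∑ k ∈ Finset.range n, (U ^ k) h‖ ^ 2 = n * ‖h‖ ^ 2 := by
  induction n with
  | zero => simp
  | succ n ih =>
    have h0 : inner ℝ h (U (∑ k ∈ Finset.range n, (U ^ k) h)) = 0 := by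
      rw [← adjoint_inner_left, hh, inner_zero_left]
    rw [sum_range_succ_pow_apply, sq, norm_add_sq_eq_norm_sq_add_norm_sq_of_inner_eq_zero _ _ h0,
      hU, ← sq, ← sq, ih]
    push_cast
    ring

theorem norm_sum_pow_apply {U : H →L[ℝ] H} (hU : ∀ x, ‖U x‖ = ‖x‖) {h : H}
    (hh : adjoint U h = 0) (n : ℕ) :
    ‖∑ k ∈ Finset.range n, (U ^ k) h‖ = √n * ‖h‖ := by
  rw [← Real.sqrt_sq (norm_nonneg (∑ k ∈ Finset.range n, (U ^ k) h)), norm_sq_sum_pow_apply hU hh,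
    Real.sqrt_mul (by positivity), Real.sqrt_sq (norm_nonneg h)]

/-- The coboundary telescopes to `U^n w - w`. -/
theorem norm_sum_pow_apply_sub_le {U : H →L[ℝ] H} (hU : ∀ x, ‖U x‖ = ‖x‖) {x h w : H}
    (hx : x = h + (U w - w)) (n : ℕ) :
    ‖∑ k ∈ Finset.range n, (U ^ k) x - ∑ k ∈ Finset.range n, (U ^ k) h‖ ≤ 2 * ‖w‖ := by
  have h1 : ∑ k ∈ Finset.range n, (U ^ k) x - ∑ k ∈ Finset.range n, (U ^ k) h
      = (U ^ n) w - w := by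
    rw [← Finset.sum_sub_distrib]
    have : ∀ k ∈ Finset.range n, (U ^ k) x - (U ^ k) h = (U ^ (k + 1)) w - (U ^ k) w := by
      intro k _
      rw [hx, map_add, map_sub, add_sub_cancel_left, pow_succ, mul_apply_eq_comp]
    rw [Finset.sum_congr rfl this, Finset.sum_range_sub (fun k => (U ^ k) w)]
    simp
  rw [h1]
  refine (norm_sub_le _ _).trans ?_
  rw [norm_pow_apply_of_norm_map hU]
  linarith

theorem tendsto_norm_sum_pow_apply_div_sqrt {U : H →L[ℝ] H} (hU : ∀ x, ‖U x‖ = ‖x‖) {x h w : H}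
    (hh : adjoint U h = 0) (hx : x = h + (U w - w)) :
    Tendsto (fun n : ℕ => ‖∑ k ∈ Finset.range n, (U ^ k) x‖ / √n) atTop (𝓝 ‖h‖) := by
  have h0 : Tendsto (fun n : ℕ => 2 * ‖w‖ / √n) atTop (𝓝 0) :=
    tendsto_const_nhds.div_atTop (Real.tendsto_sqrt_atTop.comp tendsto_natCast_atTop_atTop)
  rw [tendsto_iff_norm_sub_tendsto_zero]
  refine squeeze_zero' (Eventually.of_forall fun _ => norm_nonneg _) ?_ h0
  filter_upwards [eventually_gt_atTop 0] with n hn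
  have hn' : 0 < √(n : ℝ) := Real.sqrt_pos.2 (by exact_mod_cast hn)
  rw [Real.norm_eq_abs, div_sub' hn'.ne', abs_div, abs_of_pos hn']
  gcongr
  rw [← norm_sum_pow_apply hU hh]
  exact (abs_norm_sub_norm_le _ _).trans (norm_sum_pow_apply_sub_le hU hx n)

end HilbertIsometry

/-! ### Elementary estimates for McLeish's product -/

section ComplexEstimates

/-- The term `x²/2` cancels the quadratic term of `exp (I x)`: with `z = I x + x²/2`, `1 + z + z²/2`
differs from `1 + I x` only by `I x³/2 + x⁴/8`. The constant covers `(3/2)³ · 5 + 1`. -/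
theorem norm_exp_add_half_sq_sub_le {x : ℝ} (hx : |x| ≤ 1) :
    ‖Complex.exp (Complex.I * x + x ^ 2 / 2) - (1 + Complex.I * x)‖ ≤ 20 * |x| ^ 3 := by
  set z : ℂ := Complex.I * x + x ^ 2 / 2 with hz
  have hx0 := abs_nonneg x
  have hzn : ‖z‖ ≤ 3 / 2 * |x| := by
    refine (norm_add_le _ _).trans ?_
    simp only [norm_mul, Complex.norm_I, one_mul, Complex.norm_real, Real.norm_eq_abs, norm_div,
      norm_pow, Complex.norm_ofNat]
    nlinarith
  have h1 := Complex.norm_exp_sub_sum_le_norm_mul_exp z 3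
  have h2 : Complex.exp z - (1 + Complex.I * x) =
      (Complex.exp z - ∑ m ∈ Finset.range 3, z ^ m / m.factorial)
        + (x ^ 3 * Complex.I / 2 + x ^ 4 / 8) := by
    simp only [Finset.sum_range_succ, Finset.sum_range_zero, Nat.factorial]
    rw [hz]
    push_cast
    ring_nf
    simp only [Complex.I_sq]
    ring
  have h3 : Real.exp ‖z‖ ≤ 5 := by
    have : Real.exp ‖z‖ ≤ Real.exp (3 / 2) := Real.exp_le_exp.2 (by linarith)
    refine this.trans ?_
    have h4 : Real.exp (3 / 2) ^ 2 = Real.exp 1 ^ 3 := by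
      rw [← Real.exp_nat_mul, ← Real.exp_nat_mul]; norm_num
    have h5 : Real.exp 1 ^ 3 ≤ 2.72 ^ 3 := by
      gcongr
      exact Real.exp_one_lt_d9.le.trans (by norm_num)
    nlinarith [Real.exp_pos (3 / 2)]
  have h4 : ‖z‖ ^ 3 * Real.exp ‖z‖ ≤ (3 / 2 * |x|) ^ 3 * 5 := by gcongr
  have h5 : ‖(x : ℂ) ^ 3 * Complex.I / 2 + x ^ 4 / 8‖ ≤ |x| ^ 3 := by
    refine (norm_add_le _ _).trans ?_
    simp only [norm_mul, Complex.norm_I, mul_one, Complex.norm_real, Real.norm_eq_abs, norm_div,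
      norm_pow, Complex.norm_ofNat]
    have : |x| ^ 4 ≤ |x| ^ 3 := pow_le_pow_of_le_one hx0 hx (by norm_num)
    nlinarith [pow_nonneg hx0 3]
  rw [h2]
  refine (norm_add_le _ _).trans ((add_le_add (h1.trans h4) h5).trans ?_)
  nlinarith [pow_nonneg hx0 3]

theorem norm_one_add_I_mul_le (x : ℝ) : ‖1 + Complex.I * x‖ ≤ Real.exp (x ^ 2 / 2) := by
  have h : ‖1 + Complex.I * x‖ ^ 2 = 1 + x ^ 2 := by
    rw [← Complex.normSq_eq_norm_sq, Complex.normSq_apply]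
    simp
    ring
  have h2 : Real.exp (x ^ 2 / 2) ^ 2 = Real.exp (x ^ 2) := by
    rw [← Real.exp_nat_mul]; congr 1; push_cast; ring
  refine (sq_le_sq₀ (norm_nonneg _) (Real.exp_pos _).le).1 ?_
  rw [h, h2, add_comm]
  exact Real.add_one_le_exp _

theorem norm_exp_I_mul_add_half_sq (x : ℝ) :
    ‖Complex.exp (Complex.I * x + x ^ 2 / 2)‖ = Real.exp (x ^ 2 / 2) := by
  rw [Complex.norm_exp]
  congr 1
  simp [← Complex.ofReal_pow]

/-- Factors are exchanged one at a time, each exchange costing at most `δ` times the bound on the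
rest. -/
theorem norm_prod_sub_prod_le {R : Type*} [NormedCommRing R] [NormOneClass R] {a b : ℕ → R}
    {r δ : ℝ} (hr : 1 ≤ r) (n : ℕ) (ha : ∀ k < n, ‖a k‖ ≤ r) (hb : ∀ k < n, ‖b k‖ ≤ r)
    (hab : ∀ k < n, ‖a k - b k‖ ≤ δ) :
    ‖∏ k ∈ Finset.range n, a k - ∏ k ∈ Finset.range n, b k‖ ≤ n * δ * r ^ n := by
  induction n with
  | zero => simp
  | succ n ih =>
    have ih' := ih (fun k hk => ha k (by omega)) (fun k hk => hb k (by omega))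
      (fun k hk => hab k (by omega))
    have hδ : 0 ≤ δ := (norm_nonneg _).trans (hab n (by omega))
    have hr0 : 0 ≤ r := by linarith
    have hB : ‖∏ k ∈ Finset.range n, b k‖ ≤ r ^ n := by
      refine (Finset.norm_prod_le _ _).trans ?_
      refine (Finset.prod_le_prod (g := fun _ => r) (fun _ _ => norm_nonneg _)
        fun k hk => ?_).trans_eq (by simp)
      exact hb k (by have := Finset.mem_range.1 hk; omega)
    have hrn : r ^ n ≤ r ^ (n + 1) := pow_le_pow_right₀ hr (by omega)
    rw [Finset.prod_range_succ, Finset.prod_range_succ]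
    have e : (∏ k ∈ Finset.range n, a k) * a n - (∏ k ∈ Finset.range n, b k) * b n
        = (∏ k ∈ Finset.range n, a k - ∏ k ∈ Finset.range n, b k) * a n
          + (∏ k ∈ Finset.range n, b k) * (a n - b n) := by ring
    rw [e]
    calc _ ≤ (n * δ * r ^ n) * r + r ^ n * δ := by
          refine (norm_add_le _ _).trans (add_le_add ?_ ?_)
          · refine (norm_mul_le _ _).trans ?_
            gcongr
            exact ha n (by omega)
          · refine (norm_mul_le _ _).trans ?_
            gcongr
            exact hab n (by omega)
      _ ≤ (n * δ * r ^ n) * r + r ^ (n + 1) * δ := by gcongr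
      _ = _ := by push_cast; ring

theorem abs_exp_sub_exp_le {a b M : ℝ} (ha : a ≤ M) (hb : b ≤ M) :
    |Real.exp a - Real.exp b| ≤ Real.exp M * |a - b| := by
  have key : ∀ {a b : ℝ}, b ≤ a → a ≤ M → Real.exp a - Real.exp b ≤ Real.exp M * (a - b) := by
    intro a b hab ha
    have h1 : Real.exp a - Real.exp b = Real.exp a * (1 - Real.exp (b - a)) := by
      rw [mul_sub, ← Real.exp_add]; simp
    have h2 : 1 - Real.exp (b - a) ≤ a - b := by linarith [Real.add_one_le_exp (b - a)]
    rw [h1]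
    calc _ ≤ Real.exp a * (a - b) := by gcongr
      _ ≤ _ := by
        have : 0 ≤ a - b := by linarith
        gcongr
  rcases le_total a b with h | h
  · rw [abs_sub_comm, abs_sub_comm a b, abs_of_nonneg (by linarith [Real.exp_le_exp.2 h]),
      abs_of_nonneg (by linarith)]
    exact key h hb
  · rw [abs_of_nonneg (by linarith [Real.exp_le_exp.2 h]), abs_of_nonneg (by linarith)]
    exact key h ha

end ComplexEstimates

theorem MeasureTheory.MeasurePreserving.integral_comp_of_aestronglyMeasurable
    {X Y E : Type*} [MeasurableSpace X] [MeasurableSpace Y] [NormedAddCommGroup E] [NormedSpace ℝ E]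
    {μ : Measure X} {ν : Measure Y} {T : X → Y} (hT : MeasurePreserving T μ ν) {f : Y → E}
    (hf : AEStronglyMeasurable f ν) : ∫ x, f (T x) ∂μ = ∫ y, f y ∂ν := by
  rw [← integral_map hT.measurable.aemeasurable (by rwa [hT.map_eq]), hT.map_eq]

/-! ### Koopman operator and mean ergodic theorem -/

noncomputable section Koopman

variable {X : Type*} [MeasurableSpace X] {μ : Measure X} {T : X → X}

/-- The Koopman operator on real `L²` of a measure preserving transformation. -/
def koopman (hT : MeasurePreserving T μ μ) : Lp ℝ 2 μ →L[ℝ] Lp ℝ 2 μ :=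
  (Lp.compMeasurePreservingₗᵢ ℝ T hT).toContinuousLinearMap

theorem norm_koopman (hT : MeasurePreserving T μ μ) (F : Lp ℝ 2 μ) : ‖koopman hT F‖ = ‖F‖ :=
  Lp.norm_compMeasurePreserving F hT

theorem coeFn_koopman (hT : MeasurePreserving T μ μ) (F : Lp ℝ 2 μ) :
    koopman hT F =ᵐ[μ] F ∘ T :=
  Lp.coeFn_compMeasurePreserving F hT

theorem coeFn_koopman_pow (hT : MeasurePreserving T μ μ) (F : Lp ℝ 2 μ) (n : ℕ) :
    (koopman hT ^ n) F =ᵐ[μ] F ∘ T^[n] := by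
  induction n with
  | zero => rfl
  | succ n ih =>
    rw [pow_succ', mul_apply_eq_comp]
    exact (coeFn_koopman hT _).trans (hT.quasiMeasurePreserving.ae_eq_comp ih)

theorem coeFn_sum_koopman_pow (hT : MeasurePreserving T μ μ) (F : Lp ℝ 2 μ) (n : ℕ) :
    ⇑(∑ k ∈ Finset.range n, (koopman hT ^ k) F) =ᵐ[μ]
      fun x => ∑ k ∈ Finset.range n, F (T^[k] x) := by
  induction n with
  | zero => simpa using! Lp.coeFn_zero ℝ 2 μ
  | succ n ih =>
    rw [Finset.sum_range_succ]
    filter_upwards [Lp.coeFn_add (∑ k ∈ Finset.range n, (koopman hT ^ k) F) ((koopman hT ^ n) F),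
      ih, coeFn_koopman_pow hT F n] with x h1 h2 h3
    rw [h1, Pi.add_apply, h2, h3, Finset.sum_range_succ]
    rfl

theorem coeFn_sum_koopman_pow_toLp (hT : MeasurePreserving T μ μ) {g : X → ℝ} (hg : MemLp g 2 μ)
    (n : ℕ) :
    ⇑(∑ k ∈ Finset.range n, (koopman hT ^ k) hg.toLp) =ᵐ[μ]
      fun x => ∑ k ∈ Finset.range n, g (T^[k] x) := by
  have h : ∀ᵐ x ∂μ, ∀ k, hg.toLp g (T^[k] x) = g (T^[k] x) :=
    ae_all_iff.2 fun k => (hT.iterate k).quasiMeasurePreserving.ae_eq_comp hg.coeFn_toLp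
  filter_upwards [coeFn_sum_koopman_pow hT hg.toLp n, h] with x h1 h2
  rw [h1]
  exact Finset.sum_congr rfl fun k _ => h2 k

theorem integral_koopman_pow (hT : MeasurePreserving T μ μ) (F : Lp ℝ 2 μ) (n : ℕ) :
    ∫ x, ((koopman hT ^ n) F) x ∂μ = ∫ x, F x ∂μ := by
  rw [integral_congr_ae (coeFn_koopman_pow hT F n)]
  exact (hT.iterate n).integral_comp_of_aestronglyMeasurable (Lp.aestronglyMeasurable F)

variable [IsProbabilityMeasure μ]

theorem integrable_coeFn_Lp_two (Z : Lp ℝ 2 μ) : Integrable Z μ :=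
  (Lp.memLp Z).integrable (by norm_num)

theorem integral_abs_coeFn_le_norm (Z : Lp ℝ 2 μ) : ∫ x, |Z x| ∂μ ≤ ‖Z‖ := by
  have h1 : ∫ x, |Z x| ∂μ = (eLpNorm Z 1 μ).toReal := by
    rw [eLpNorm_one_eq_lintegral_enorm]
    exact integral_norm_eq_lintegral_enorm (Lp.aestronglyMeasurable Z)
  rw [h1, Lp.norm_def]
  exact ENNReal.toReal_mono (Lp.eLpNorm_ne_top Z)
    (eLpNorm_le_eLpNorm_of_exponent_le (by norm_num) (Lp.aestronglyMeasurable Z))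

theorem inner_const_one (Z : Lp ℝ 2 μ) : inner ℝ (Lp.const 2 μ (1 : ℝ)) Z = ∫ x, Z x ∂μ := by
  rw [L2.inner_def]
  refine integral_congr_ae ?_
  filter_upwards [Lp.coeFn_const 2 μ (1 : ℝ)] with x hx
  rw [hx]
  simp

/-- The mean ergodic theorem for an ergodic transformation. -/
theorem Ergodic.tendsto_smul_sum_koopman_pow (hT : Ergodic T μ) (F : Lp ℝ 2 μ) :
    Tendsto (fun n : ℕ =>
        (n : ℝ)⁻¹ • ∑ k ∈ Finset.range n, (koopman hT.toMeasurePreserving ^ k) F) atTop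
      (𝓝 (Lp.const 2 μ (∫ x, F x ∂μ))) := by
  set U := koopman hT.toMeasurePreserving with hU
  have hU1 : ‖U‖ ≤ 1 :=
    U.opNorm_le_bound zero_le_one fun x => by rw [one_mul, norm_koopman]
  have hlim := U.tendsto_birkhoffAverage_orthogonalProjection hU1 F
  set L : Lp ℝ 2 μ :=
    ((U.eqLocus (1 : Lp ℝ 2 μ →L[ℝ] Lp ℝ 2 μ)).orthogonalProjectionOnto F : Lp ℝ 2 μ)
    with hL
  have hLU : U L = L :=
    ((U.eqLocus (1 : Lp ℝ 2 μ →L[ℝ] Lp ℝ 2 μ)).orthogonalProjectionOnto F).2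
  have hav : ∀ n : ℕ, birkhoffAverage ℝ U _root_.id n F
      = (n : ℝ)⁻¹ • ∑ k ∈ Finset.range n, (U ^ k) F := by
    intro n
    simp [birkhoffAverage, birkhoffSum]
  simp only [hav] at hlim
  -- Ergodicity makes the invariant limit constant; since all averages have the same integral,
  -- pairing with `1` identifies the constant.
  obtain ⟨c, hc⟩ := hT.quasiErgodic.ae_eq_const_of_ae_eq_comp_ae (Lp.aestronglyMeasurable L)
    ((coeFn_koopman hT.toMeasurePreserving L).symm.trans (by rw [← hU, hLU]))
  have hLc : L = Lp.const 2 μ c := Lp.ext (hc.trans (Lp.coeFn_const 2 μ c).symm)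
  have hint : Tendsto (fun n : ℕ => inner ℝ (Lp.const 2 μ (1 : ℝ))
      ((n : ℝ)⁻¹ • ∑ k ∈ Finset.range n, (U ^ k) F)) atTop
      (𝓝 (inner ℝ (Lp.const 2 μ (1 : ℝ)) L)) := tendsto_const_nhds.inner hlim
  have hint2 : ∀ᶠ n : ℕ in atTop, inner ℝ (Lp.const 2 μ (1 : ℝ))
      ((n : ℝ)⁻¹ • ∑ k ∈ Finset.range n, (U ^ k) F) = ∫ x, F x ∂μ := by
    filter_upwards [eventually_gt_atTop 0] with n hn
    rw [inner_smul_right, inner_sum]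
    simp only [inner_const_one, hU, integral_koopman_pow]
    simp
    field_simp
  have hcF : ∫ x, F x ∂μ = c := by
    have h1 := tendsto_nhds_unique (tendsto_const_nhds.congr' (hint2.mono fun _ h => h.symm)) hint
    rw [h1, inner_const_one, integral_congr_ae hc]
    simp
  rw [hcF, ← hLc]
  exact hlim

theorem Ergodic.tendsto_integral_abs_average_sub (hT : Ergodic T μ) {v : X → ℝ}
    (hv : MemLp v 2 μ) :
    Tendsto (fun n : ℕ => ∫ x, |(∑ k ∈ Finset.range n, v (T^[k] x)) / n - ∫ y, v y ∂μ| ∂μ) atTop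
      (𝓝 0) := by
  have h := hT.tendsto_smul_sum_koopman_pow hv.toLp
  rw [integral_congr_ae hv.coeFn_toLp, tendsto_iff_norm_sub_tendsto_zero] at h
  refine squeeze_zero (fun n => integral_nonneg fun _ => abs_nonneg _) (fun n => ?_) h
  refine le_trans (le_of_eq (integral_congr_ae ?_)) (integral_abs_coeFn_le_norm _)
  set S := ∑ k ∈ Finset.range n, (koopman hT.toMeasurePreserving ^ k) hv.toLp
  filter_upwards [Lp.coeFn_sub ((n : ℝ)⁻¹ • S) (Lp.const 2 μ (∫ y, v y ∂μ)),
    Lp.coeFn_smul (n : ℝ)⁻¹ S, Lp.coeFn_const 2 μ (∫ y, v y ∂μ),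
    coeFn_sum_koopman_pow_toLp hT.toMeasurePreserving hv n] with x h1 h2 h3 h4
  rw [h1, Pi.sub_apply, h2, h3, Pi.smul_apply, h4]
  simp [div_eq_inv_mul]

end Koopman

/-! ### McLeish's argument for bounded reversed martingale differences -/

section BoundedCLT

variable {X : Type*} [MeasurableSpace X] {μ : Measure X} {T : X → X}

theorem measurable_iterate_comp (hT : MeasurePreserving T μ μ) {Y : Type*} [MeasurableSpace Y]
    {g : X → Y} (hg : Measurable g) (k : ℕ) : Measurable fun x => g (T^[k] x) :=
  hg.comp (hT.iterate k).measurable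

variable [IsProbabilityMeasure μ]

theorem integrable_of_measurable_of_bounded {E : Type*} [NormedAddCommGroup E]
    [MeasurableSpace E] [BorelSpace E] [SecondCountableTopology E] {u : X → E} (hu : Measurable u)
    {C : ℝ} (hC : ∀ x, ‖u x‖ ≤ C) : Integrable u μ :=
  Integrable.of_bound hu.aestronglyMeasurable C (Eventually.of_forall hC)

/-- McLeish's product has mean one for reversed martingale differences. -/
theorem integral_prod_one_add_eq_one (hT : MeasurePreserving T μ μ) {g : X → ℝ}
    (hgm : Measurable g) {K : ℝ} (hK : ∀ x, |g x| ≤ K)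
    (horth : ∀ u : X → ℂ, Measurable u → (∃ C : ℝ, ∀ x, ‖u x‖ ≤ C) →
      ∫ x, (g x : ℂ) * u (T x) ∂μ = 0) (a : ℝ) (n : ℕ) :
    ∫ x, ∏ k ∈ Finset.range n, (1 + Complex.I * ((a * g (T^[k] x) : ℝ) : ℂ)) ∂μ = 1 := by
  induction n with
  | zero => simp
  | succ n ih =>
    set G : X → ℂ := fun x =>
      ∏ k ∈ Finset.range n, (1 + Complex.I * ((a * g (T^[k] x) : ℝ) : ℂ)) with hG
    have hGm : Measurable G := by
      refine Finset.measurable_fun_prod _ fun k _ => ?_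
      exact (Complex.measurable_ofReal.comp
        ((measurable_iterate_comp hT hgm k).const_mul a)).const_mul Complex.I |>.const_add 1
    have hGb : ∀ x, ‖G x‖ ≤ (1 + |a| * K) ^ n := by
      intro x
      refine (Finset.norm_prod_le _ _).trans ?_
      refine (Finset.prod_le_prod (g := fun _ => 1 + |a| * K) (fun _ _ => norm_nonneg _)
        fun k _ => ?_).trans_eq (by simp)
      refine (norm_add_le _ _).trans ?_
      rw [norm_one, norm_mul, Complex.norm_I, one_mul, Complex.norm_real, Real.norm_eq_abs, abs_mul]
      gcongr
      exact hK _
    -- Time being reversed, the factor `k = 0` is split off: the others form a bounded function of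
    -- `T x`, to which `g` is orthogonal.
    have e : ∀ x, ∏ k ∈ Finset.range (n + 1), (1 + Complex.I * ((a * g (T^[k] x) : ℝ) : ℂ))
        = G (T x) + Complex.I * a * ((g x : ℂ) * G (T x)) := by
      intro x
      rw [Finset.prod_range_succ']
      simp only [Function.iterate_succ_apply, Function.iterate_zero_apply, hG]
      push_cast
      ring
    have hGT : Integrable (fun x => G (T x)) μ :=
      integrable_of_measurable_of_bounded (hGm.comp hT.measurable) fun x => hGb _
    have hgG : Integrable (fun x => (g x : ℂ) * G (T x)) μ := by
      refine hGT.bdd_mul (c := K) (Complex.measurable_ofReal.comp hgm).aestronglyMeasurable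
        (Eventually.of_forall fun x => ?_)
      simpa using hK x
    simp only [e]
    rw [integral_add hGT (hgG.const_mul _), integral_const_mul, horth G hGm ⟨_, hGb⟩, mul_zero,
      add_zero, hT.integral_comp_of_aestronglyMeasurable hGm.aestronglyMeasurable, ih]

/-- The first error term replaces the empirical variance by `s`; the second sums `n` cubic errors of
size `(|t| K / √n)³`. The condition `|t| * K ≤ √n` keeps each factor's argument in `[-1, 1]`. -/
theorem norm_exp_mul_sub_prod_le {t K s : ℝ} {n : ℕ} (hn : 0 < n) (htK : |t| * K ≤ √n)
    {y : ℕ → ℝ} (hy : ∀ k, |y k| ≤ K) (hs : s ≤ K ^ 2) :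
    ‖Complex.exp (Complex.I * ((t * ((∑ k ∈ Finset.range n, y k) / √n) : ℝ) : ℂ))
          * Real.exp (t ^ 2 * s / 2)
        - ∏ k ∈ Finset.range n, (1 + Complex.I * ((t / √n * y k : ℝ) : ℂ))‖ ≤
      Real.exp (t ^ 2 * K ^ 2 / 2) * (t ^ 2 / 2) * |(∑ k ∈ Finset.range n, y k ^ 2) / n - s|
        + 20 * (|t| * K) ^ 3 * Real.exp (t ^ 2 * K ^ 2 / 2) / √n := by
  have hn' : (0 : ℝ) < n := by exact_mod_cast hn
  have hr : 0 < √(n : ℝ) := Real.sqrt_pos.2 hn'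
  have hrr : √(n : ℝ) ^ 2 = n := Real.sq_sqrt hn'.le
  have hK : 0 ≤ K := (abs_nonneg _).trans (hy 0)
  set V := (∑ k ∈ Finset.range n, y k ^ 2) / n with hV
  have hVK : V ≤ K ^ 2 := by
    rw [hV, div_le_iff₀ hn']
    refine (Finset.sum_le_card_nsmul _ _ (K ^ 2) fun k _ => ?_).trans_eq (by simp [mul_comm])
    exact sq_le_sq.2 (by rw [abs_of_nonneg hK]; exact hy k)
  set e := Complex.exp (Complex.I * ((t * ((∑ k ∈ Finset.range n, y k) / √n) : ℝ) : ℂ)) with he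
  have hen : ‖e‖ = 1 := by rw [he, mul_comm, Complex.norm_exp_ofReal_mul_I]
  set ξ : ℕ → ℝ := fun k => t / √n * y k with hξ
  have hξK : ∀ k, |ξ k| ≤ |t| * K / √n := by
    intro k
    simp only [hξ, abs_mul, abs_div, abs_of_pos hr]
    rw [div_mul_eq_mul_div]
    gcongr
    exact hy k
  have hξ1 : ∀ k, |ξ k| ≤ 1 := fun k => (hξK k).trans ((div_le_one hr).2 htK)
  have hprod : e * Real.exp (t ^ 2 * V / 2) =
      ∏ k ∈ Finset.range n, Complex.exp (Complex.I * ξ k + (ξ k : ℂ) ^ 2 / 2) := by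
    rw [← Complex.exp_sum, Complex.ofReal_exp, he, ← Complex.exp_add, Finset.sum_add_distrib,
      ← Finset.mul_sum, ← Finset.sum_div]
    congr 2
    · rw [← Complex.ofReal_sum]
      congr 2
      simp only [hξ, ← Finset.mul_sum]
      ring
    · simp only [← Complex.ofReal_pow]
      rw [← Complex.ofReal_sum]
      have : ∑ k ∈ Finset.range n, ξ k ^ 2 = t ^ 2 * V := by
        simp only [hξ, mul_pow, ← Finset.mul_sum, div_pow, hrr, hV]
        ring
      rw [this]
      push_cast
      rfl
  -- This bounds every factor of both products, and `r ^ n` does not depend on `n`.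
  set r := Real.exp ((|t| * K / √n) ^ 2 / 2) with hrdef
  have hrn : r ^ n = Real.exp (t ^ 2 * K ^ 2 / 2) := by
    rw [hrdef, ← Real.exp_nat_mul, div_pow, hrr, mul_pow, sq_abs]
    congr 1
    field_simp
  have hξr : ∀ k, Real.exp (ξ k ^ 2 / 2) ≤ r := by
    intro k
    refine Real.exp_le_exp.2 ?_
    have := pow_le_pow_left₀ (abs_nonneg _) (hξK k) 2
    rw [sq_abs] at this
    linarith
  have h2 := norm_prod_sub_prod_le (r := r) (δ := 20 * (|t| * K / √n) ^ 3)
    (a := fun k => Complex.exp (Complex.I * ξ k + (ξ k : ℂ) ^ 2 / 2))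
    (b := fun k => 1 + Complex.I * (ξ k : ℂ)) (Real.one_le_exp (by positivity)) n
    (fun k _ => by rw [norm_exp_I_mul_add_half_sq]; exact hξr k)
    (fun k _ => (norm_one_add_I_mul_le _).trans (hξr k))
    (fun k _ => (norm_exp_add_half_sq_sub_le (hξ1 k)).trans (by have := hξK k; gcongr))
  rw [← hprod, hrn] at h2
  have h1 : ‖e * Real.exp (t ^ 2 * s / 2) - e * Real.exp (t ^ 2 * V / 2)‖ ≤
      Real.exp (t ^ 2 * K ^ 2 / 2) * (t ^ 2 / 2) * |V - s| := by
    rw [← mul_sub, norm_mul, hen, one_mul, ← Complex.ofReal_sub, Complex.norm_real,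
      Real.norm_eq_abs]
    refine (abs_exp_sub_exp_le (M := t ^ 2 * K ^ 2 / 2) (by gcongr) (by gcongr)).trans_eq ?_
    have : t ^ 2 * s / 2 - t ^ 2 * V / 2 = t ^ 2 / 2 * (s - V) := by ring
    rw [this, abs_mul, abs_of_nonneg (by positivity : 0 ≤ t ^ 2 / 2), abs_sub_comm s V, mul_assoc]
  have h3 : (n : ℝ) * (20 * (|t| * K / √n) ^ 3) * Real.exp (t ^ 2 * K ^ 2 / 2)
      = 20 * (|t| * K) ^ 3 * Real.exp (t ^ 2 * K ^ 2 / 2) / √n := by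
    rw [div_pow]
    field_simp
    rw [hrr]
    ring
  rw [h3] at h2
  calc _ = ‖(e * Real.exp (t ^ 2 * s / 2) - e * Real.exp (t ^ 2 * V / 2))
      + (e * Real.exp (t ^ 2 * V / 2) - ∏ k ∈ Finset.range n, (1 + Complex.I * (ξ k : ℂ)))‖ := by
        rw [sub_add_sub_cancel]
    _ ≤ _ := (norm_add_le _ _).trans (add_le_add h1 h2)

/-- The central limit theorem for bounded reversed martingale differences, in terms of
characteristic functions. -/
theorem Ergodic.tendsto_integral_exp_of_bounded (hT : Ergodic T μ) {g : X → ℝ}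
    (hgm : Measurable g) {K : ℝ} (hK : ∀ x, |g x| ≤ K)
    (horth : ∀ u : X → ℂ, Measurable u → (∃ C : ℝ, ∀ x, ‖u x‖ ≤ C) →
      ∫ x, (g x : ℂ) * u (T x) ∂μ = 0) (t : ℝ) :
    Tendsto (fun n : ℕ => ∫ x, Complex.exp
        (Complex.I * ((t * ((∑ k ∈ Finset.range n, g (T^[k] x)) / √n) : ℝ) : ℂ)) ∂μ) atTop
      (𝓝 (Real.exp (-(t ^ 2 * (∫ x, g x ^ 2 ∂μ) / 2)) : ℂ)) := by
  have hTm := hT.toMeasurePreserving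
  set s := ∫ x, g x ^ 2 ∂μ with hs
  obtain ⟨x0⟩ : Nonempty X := (inferInstance : NeZero μ).1 |> fun h => by
    by_contra hX
    rw [not_nonempty_iff] at hX
    exact h (Measure.eq_zero_of_isEmpty μ)
  have hK0 : 0 ≤ K := (abs_nonneg _).trans (hK x0)
  have hgK : ∀ x, g x ^ 2 ≤ K ^ 2 := fun x =>
    sq_le_sq.2 (by rw [abs_of_nonneg hK0]; exact hK x)
  have hg2m : Measurable fun x => g x ^ 2 := hgm.pow_const 2
  have hg2b : ∀ x, ‖g x ^ 2‖ ≤ K ^ 2 := fun x => by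
    rw [Real.norm_eq_abs, abs_of_nonneg (sq_nonneg _)]; exact hgK x
  have hg2i : Integrable (fun x => g x ^ 2) μ := integrable_of_measurable_of_bounded hg2m hg2b
  have hsK : s ≤ K ^ 2 := by
    refine (integral_mono hg2i (integrable_const (K ^ 2)) hgK).trans_eq (by simp)
  set E : ℕ → X → ℂ := fun n x => Complex.exp
    (Complex.I * ((t * ((∑ k ∈ Finset.range n, g (T^[k] x)) / √n) : ℝ) : ℂ)) with hE
  have hSm : ∀ n : ℕ, Measurable fun x => ∑ k ∈ Finset.range n, g (T^[k] x) := fun n =>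
    Finset.measurable_fun_sum _ fun k _ => measurable_iterate_comp hTm hgm k
  have hEi : ∀ n, Integrable (E n) μ := fun n => by
    refine integrable_of_measurable_of_bounded (C := 1) ?_ fun x => ?_
    · have := hSm n
      fun_prop
    · simp only [hE]
      rw [mul_comm, Complex.norm_exp_ofReal_mul_I]
  set c : ℝ := Real.exp (t ^ 2 * s / 2) with hc
  set M : ℝ := Real.exp (t ^ 2 * K ^ 2 / 2) with hM
  have hsqrt : Tendsto (fun n : ℕ => √(n : ℝ)) atTop atTop :=
    Real.tendsto_sqrt_atTop.comp tendsto_natCast_atTop_atTop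
  -- Multiplying by `c` makes the expected limit `1`, the exact mean of McLeish's product.
  have key : Tendsto (fun n => (∫ x, E n x ∂μ) * c) atTop (𝓝 1) := by
    rw [tendsto_iff_norm_sub_tendsto_zero]
    have hV := hT.tendsto_integral_abs_average_sub (v := fun x => g x ^ 2)
      (MemLp.of_bound hg2m.aestronglyMeasurable _ (Eventually.of_forall hg2b))
    have hlim := (hV.const_mul (M * (t ^ 2 / 2))).add
      ((tendsto_const_nhds (x := 20 * (|t| * K) ^ 3 * M)).div_atTop hsqrt)
    rw [mul_zero, add_zero] at hlim
    refine squeeze_zero' (Eventually.of_forall fun _ => norm_nonneg _) ?_ hlim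
    filter_upwards [eventually_gt_atTop 0, hsqrt.eventually_ge_atTop (|t| * K)] with n hn htK
    set R : X → ℂ := fun x =>
      ∏ k ∈ Finset.range n, (1 + Complex.I * ((t / √n * g (T^[k] x) : ℝ) : ℂ)) with hR
    have hRint : ∫ x, R x ∂μ = 1 := integral_prod_one_add_eq_one hTm hgm hK horth _ n
    -- A non-integrable function has Bochner integral `0`, whereas this integral is `1`.
    have hRi : Integrable R μ := by
      by_contra h
      rw [integral_undef h] at hRint
      exact zero_ne_one hRint
    have hAi : Integrable (fun x => |(∑ k ∈ Finset.range n, g (T^[k] x) ^ 2) / n - s|) μ := by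
      refine Integrable.abs (Integrable.sub (Integrable.div_const ?_ _) (integrable_const _))
      refine integrable_finsetSum _ fun k _ => ?_
      exact integrable_of_measurable_of_bounded (measurable_iterate_comp hTm hg2m k)
        fun x => hg2b _
    rw [← hRint, ← integral_mul_const, ← integral_sub ((hEi n).mul_const _) hRi]
    refine (norm_integral_le_of_norm_le (((hAi.const_mul (M * (t ^ 2 / 2))).add
      (integrable_const (20 * (|t| * K) ^ 3 * M / √n)))) (Eventually.of_forall fun x =>
        norm_exp_mul_sub_prod_le hn htK (fun k => hK _) hsK)).trans_eq ?_
    simp only [Pi.add_apply]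
    rw [integral_add (hAi.const_mul _) (integrable_const _), integral_const_mul]
    simp [hs]
  have := key.mul_const (Real.exp (-(t ^ 2 * s / 2)) : ℂ)
  simpa only [mul_assoc, hc, ← Complex.ofReal_mul, ← Real.exp_add, add_neg_cancel, Real.exp_zero,
    Complex.ofReal_one, mul_one, one_mul] using this

end BoundedCLT

/-! ### The transfer operator and bounded approximation in its kernel -/

section TransferOperator

open ContinuousLinearMap

variable {X : Type*} [MeasurableSpace X] {μ : Measure X} [IsProbabilityMeasure μ] {T : X → X}

/-- Against the indicator of `s`, the adjoint of `c` integrates to the integral of `c` over `T⁻¹ s`.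
-/
theorem adjoint_koopman_nonneg (hT : MeasurePreserving T μ μ) {c : Lp ℝ 2 μ}
    (hc : 0 ≤ᵐ[μ] c) : 0 ≤ᵐ[μ] adjoint (koopman hT) c := by
  refine ae_nonneg_of_forall_setIntegral_nonneg (integrable_coeFn_Lp_two _) fun s hs hμs => ?_
  rw [← L2.inner_indicatorConstLp_one (𝕜 := ℝ) hs hμs.ne, adjoint_inner_right, L2.inner_def]
  refine integral_nonneg_of_ae ?_
  filter_upwards [hc, coeFn_koopman hT (indicatorConstLp 2 hs hμs.ne (1 : ℝ)),
    hT.quasiMeasurePreserving.ae_eq_comp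
      (indicatorConstLp_coeFn (p := 2) (hs := hs) (hμs := hμs.ne) (c := (1 : ℝ)))] with x h1 h2 h3
  rw [h2, h3]
  refine mul_nonneg h1 (?_ : 0 ≤ s.indicator (fun _ => (1 : ℝ)) (T x))
  exact indicator_nonneg (fun _ _ => zero_le_one) _

theorem adjoint_koopman_const (hT : MeasurePreserving T μ μ) (K : ℝ) :
    adjoint (koopman hT) (Lp.const 2 μ K) = Lp.const 2 μ K := by
  have h : koopman hT (Lp.const 2 μ K) = Lp.const 2 μ K := by
    refine Lp.ext ?_
    refine (coeFn_koopman hT _).trans ?_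
    refine (hT.quasiMeasurePreserving.ae_eq_comp (Lp.coeFn_const 2 μ K)).trans ?_
    exact (Lp.coeFn_const 2 μ K).symm
  conv_lhs => rw [← h]
  exact adjoint_apply_apply_of_norm_map (norm_koopman hT) _

/-- Positivity is applied to `K - c`, the constants being fixed. -/
theorem adjoint_koopman_le (hT : MeasurePreserving T μ μ) {c : Lp ℝ 2 μ} {K : ℝ}
    (hc : ∀ᵐ x ∂μ, c x ≤ K) : ∀ᵐ x ∂μ, adjoint (koopman hT) c x ≤ K := by
  have h : 0 ≤ᵐ[μ] (Lp.const 2 μ K - c : Lp ℝ 2 μ) := by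
    filter_upwards [hc, Lp.coeFn_sub (Lp.const 2 μ K) c, Lp.coeFn_const 2 μ K] with x h1 h2 h3
    rw [h2, Pi.sub_apply, h3]
    simpa using h1
  have h' := adjoint_koopman_nonneg hT h
  rw [map_sub, adjoint_koopman_const] at h'
  filter_upwards [h', Lp.coeFn_sub (Lp.const 2 μ K) (adjoint (koopman hT) c),
    Lp.coeFn_const 2 μ K] with x h1 h2 h3
  rw [h2, Pi.sub_apply, h3] at h1
  simpa using h1

theorem abs_adjoint_koopman_le (hT : MeasurePreserving T μ μ) {c : Lp ℝ 2 μ} {K : ℝ}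
    (hc : ∀ᵐ x ∂μ, |c x| ≤ K) : ∀ᵐ x ∂μ, |adjoint (koopman hT) c x| ≤ K := by
  have h1 := adjoint_koopman_le hT (hc.mono fun x hx => (abs_le.1 hx).2)
  have h2 : ∀ᵐ x ∂μ, (-c) x ≤ K := by
    filter_upwards [hc, Lp.coeFn_neg c] with x h3 h4
    rw [h4, Pi.neg_apply]
    linarith [(abs_le.1 h3).1]
  have h2 := adjoint_koopman_le hT h2
  rw [map_neg] at h2
  filter_upwards [h1, h2, Lp.coeFn_neg (adjoint (koopman hT) c)] with x h3 h4 h5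
  rw [h5, Pi.neg_apply] at h4
  exact abs_le.2 ⟨by linarith, h3⟩

/-- For real `v`, the integral of `g · (v ∘ T)` is `⟨g, U v⟩ = ⟨U* g, v⟩`. This supplies the
orthogonality hypothesis of the bounded CLT. -/
theorem integral_mul_comp_eq_zero_of_adjoint_koopman_eq_zero (hT : MeasurePreserving T μ μ)
    {g : X → ℝ} (hg : MemLp g 2 μ) (h0 : adjoint (koopman hT) hg.toLp = 0) {u : X → ℂ}
    (hu : Measurable u) {C : ℝ} (hC : ∀ x, ‖u x‖ ≤ C) : ∫ x, (g x : ℂ) * u (T x) ∂μ = 0 := by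
  have key : ∀ v : X → ℝ, Measurable v → (∀ x, ‖v x‖ ≤ C) → ∫ x, g x * v (T x) ∂μ = 0 := by
    intro v hv hvC
    have hv2 : MemLp v 2 μ :=
      MemLp.of_bound hv.aestronglyMeasurable C (Eventually.of_forall hvC)
    have h1 : inner ℝ (hg.toLp g) (koopman hT (hv2.toLp v)) = 0 := by
      rw [← adjoint_inner_left, h0, inner_zero_left]
    rw [L2.inner_def] at h1
    rw [← h1]
    refine integral_congr_ae ?_
    filter_upwards [hg.coeFn_toLp, coeFn_koopman hT (hv2.toLp v),
      hT.quasiMeasurePreserving.ae_eq_comp hv2.coeFn_toLp] with x h2 h3 h4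
    rw [h2, h3, h4]
    simp [mul_comm]
  have hgi : Integrable (fun x => (g x : ℂ)) μ := (hg.integrable (by norm_num)).ofReal
  have hi : Integrable (fun x => (g x : ℂ) * u (T x)) μ :=
    hgi.mul_bdd (c := C) (hu.comp hT.measurable).aestronglyMeasurable
      (Eventually.of_forall fun x => hC _)
  have hre := key (fun x => (u x).re) (Complex.measurable_re.comp hu)
    fun x => (Complex.abs_re_le_norm _).trans (hC x)
  have him := key (fun x => (u x).im) (Complex.measurable_im.comp hu)
    fun x => (Complex.abs_im_le_norm _).trans (hC x)
  apply Complex.ext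
  · have := integral_re hi
    simp only [RCLike.re_to_complex, Complex.re_ofReal_mul] at this
    rw [← this, hre, Complex.zero_re]
  · have := integral_im hi
    simp only [RCLike.im_to_complex, Complex.im_ofReal_mul] at this
    rw [← this, him, Complex.zero_im]

/-- Vectors in the kernel of the adjoint of the Koopman operator are limits of bounded ones. -/
theorem exists_bounded_adjoint_koopman_eq_zero (hT : MeasurePreserving T μ μ) {h : Lp ℝ 2 μ}
    (h0 : adjoint (koopman hT) h = 0) {ε : ℝ} (hε : 0 < ε) :
    ∃ (g : X → ℝ) (hg : MemLp g 2 μ) (K : ℝ), Measurable g ∧ (∀ x, |g x| ≤ K) ∧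
      adjoint (koopman hT) hg.toLp = 0 ∧ ‖h - hg.toLp‖ < ε := by
  -- The approximant will be `C - U U* C`, and the triangle inequality bounds `1 - U U*` by `2`;
  -- hence `ε / 2`.
  obtain ⟨c, hc1, hc2⟩ := (Lp.memLp h).exists_simpleFunc_eLpNorm_sub_lt (by norm_num)
    (ε := ENNReal.ofReal (ε / 2)) (by simpa using hε)
  obtain ⟨K, hK⟩ := c.exists_forall_norm_le
  set C : Lp ℝ 2 μ := hc2.toLp c with hC
  have hdist : ‖h - C‖ < ε / 2 := by
    have e : h - C = ((Lp.memLp h).sub hc2).toLp _ := by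
      rw [MemLp.toLp_sub (Lp.memLp h) hc2, Lp.toLp_coeFn]
    rw [e, Lp.norm_toLp]
    exact ENNReal.toReal_lt_of_lt_ofReal hc1
  set p := adjoint (koopman hT) C with hp
  have hpK : ∀ᵐ x ∂μ, |p x| ≤ K := by
    refine abs_adjoint_koopman_le hT ?_
    filter_upwards [hc2.coeFn_toLp] with x hx
    rw [hx]
    exact hK x
  -- Truncation selects a measurable version of `p` bounded at every point, not just almost
  -- everywhere.
  set q : X → ℝ := fun x => max (-K) (min K (p x)) with hq
  have hqm : Measurable q :=
    measurable_const.max (measurable_const.min (Lp.stronglyMeasurable p).measurable)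
  have hqp : q =ᵐ[μ] p := by
    filter_upwards [hpK] with x hx
    obtain ⟨h1, h2⟩ := abs_le.1 hx
    simp only [hq]
    rw [min_eq_right h2, max_eq_right h1]
  set g : X → ℝ := fun x => c x - q (T x) with hgdef
  have hgm : Measurable g := c.measurable.sub (hqm.comp hT.measurable)
  have hgK : ∀ x, |g x| ≤ 2 * K := by
    intro x
    have hK0 : -K ≤ K := by linarith [(norm_nonneg _).trans (hK x)]
    have h1 : |q (T x)| ≤ K := abs_le.2 ⟨le_max_left _ _, max_le hK0 (min_le_left _ _)⟩
    have h2 : |c x| ≤ K := hK x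
    calc |g x| ≤ |c x| + |q (T x)| := abs_sub _ _
      _ ≤ _ := by linarith
  have hg : MemLp g 2 μ :=
    MemLp.of_bound hgm.aestronglyMeasurable (2 * K) (Eventually.of_forall hgK)
  have hgC : hg.toLp g = C - koopman hT p := by
    refine Lp.ext ?_
    filter_upwards [hg.coeFn_toLp, Lp.coeFn_sub C (koopman hT p), hc2.coeFn_toLp,
      coeFn_koopman hT p, hT.quasiMeasurePreserving.ae_eq_comp hqp] with x h1 h2 h3 h4 h5
    rw [h1, h2, Pi.sub_apply, h3, h4, ← h5]
    rfl
  refine ⟨g, hg, 2 * K, hgm, hgK, ?_, ?_⟩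
  · rw [hgC, map_sub, adjoint_apply_apply_of_norm_map (norm_koopman hT), hp, sub_self]
  · have e : h - hg.toLp g = (h - C) - koopman hT (adjoint (koopman hT) (h - C)) := by
      rw [hgC, map_sub (adjoint (koopman hT)), h0, zero_sub, map_neg]
      abel
    have hle : ‖adjoint (koopman hT) (h - C)‖ ≤ ‖h - C‖ := by
      have : ‖adjoint (koopman hT)‖ ≤ 1 := by
        rw [LinearIsometryEquiv.norm_map]
        exact opNorm_le_bound _ zero_le_one fun x => by rw [one_mul, norm_koopman]
      simpa using (adjoint (koopman hT)).le_of_opNorm_le this (h - C)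
    rw [e]
    refine (norm_sub_le _ _).trans_lt ?_
    rw [norm_koopman]
    linarith

end TransferOperator

/-! ### From bounded to square integrable differences -/

section SquareIntegrableCLT

open ContinuousLinearMap

variable {X : Type*} [MeasurableSpace X] {μ : Measure X} [IsProbabilityMeasure μ] {T : X → X}

theorem norm_exp_I_mul_sub_exp_I_mul_le (a b : ℝ) :
    ‖Complex.exp (Complex.I * a) - Complex.exp (Complex.I * b)‖ ≤ |a - b| := by
  have e : Complex.exp (Complex.I * a) - Complex.exp (Complex.I * b)
      = Complex.exp (Complex.I * b) * (Complex.exp (Complex.I * ((a - b : ℝ) : ℂ)) - 1) := by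
    rw [mul_sub, ← Complex.exp_add]
    push_cast
    ring_nf
  rw [e, norm_mul, mul_comm Complex.I (b : ℂ), Complex.norm_exp_ofReal_mul_I, one_mul]
  exact Real.norm_exp_I_mul_ofReal_sub_one_le

theorem integrable_exp_I_mul (t : ℝ) (Z : Lp ℝ 2 μ) :
    Integrable (fun x => Complex.exp (Complex.I * ((t * Z x : ℝ) : ℂ))) μ := by
  refine integrable_of_measurable_of_bounded (C := 1) ?_ fun x => ?_
  · have := (Lp.stronglyMeasurable Z).measurable
    fun_prop
  · rw [mul_comm, Complex.norm_exp_ofReal_mul_I]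

/-- `exp (I x)` is 1-Lipschitz and the `L¹` norm is at most the `L²` norm. -/
theorem norm_integral_exp_sub_integral_exp_le (t : ℝ) (Z W : Lp ℝ 2 μ) :
    ‖∫ x, Complex.exp (Complex.I * ((t * Z x : ℝ) : ℂ)) ∂μ
        - ∫ x, Complex.exp (Complex.I * ((t * W x : ℝ) : ℂ)) ∂μ‖ ≤ |t| * ‖Z - W‖ := by
  rw [← integral_sub (integrable_exp_I_mul t Z) (integrable_exp_I_mul t W)]
  refine (norm_integral_le_of_norm_le (g := fun x => |t| * |(Z - W) x|)
    ((integrable_coeFn_Lp_two _).abs.const_mul _) ?_).trans ?_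
  · filter_upwards [Lp.coeFn_sub Z W] with x hx
    refine (norm_exp_I_mul_sub_exp_I_mul_le _ _).trans_eq ?_
    rw [hx, Pi.sub_apply, ← mul_sub, abs_mul]
  · rw [integral_const_mul]
    gcongr
    exact integral_abs_coeFn_le_norm _

/-- The central limit theorem for a coboundary plus a square integrable reversed martingale
difference, in terms of characteristic functions. -/
theorem Ergodic.tendsto_integral_exp_sum_koopman_pow (hT : Ergodic T μ) {F h w : Lp ℝ 2 μ}
    (hh : adjoint (koopman hT.toMeasurePreserving) h = 0)
    (hF : F = h + (koopman hT.toMeasurePreserving w - w)) (t : ℝ) :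
    Tendsto (fun n : ℕ => ∫ x, Complex.exp (Complex.I * ((t * ((√(n : ℝ))⁻¹ •
        ∑ k ∈ Finset.range n, (koopman hT.toMeasurePreserving ^ k) F : Lp ℝ 2 μ) x : ℝ) : ℂ)) ∂μ)
      atTop (𝓝 (Real.exp (-(t ^ 2 * ‖h‖ ^ 2 / 2)) : ℂ)) := by
  have hTm := hT.toMeasurePreserving
  set U := koopman hT.toMeasurePreserving with hU
  have hUn : ∀ x, ‖U x‖ = ‖x‖ := norm_koopman hTm
  set J : Lp ℝ 2 μ → ℂ := fun Z => ∫ x, Complex.exp (Complex.I * ((t * Z x : ℝ) : ℂ)) ∂μ with hJ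
  set A : ℕ → Lp ℝ 2 μ → Lp ℝ 2 μ :=
    fun n Z => (√(n : ℝ))⁻¹ • ∑ k ∈ Finset.range n, (U ^ k) Z with hA
  change Tendsto (fun n => J (A n F)) atTop _
  set φ : Lp ℝ 2 μ → ℂ := fun Z => (Real.exp (-(t ^ 2 * ‖Z‖ ^ 2 / 2)) : ℂ) with hφ
  have hφc : Continuous φ := by
    simp only [hφ]
    fun_prop
  rw [Metric.tendsto_nhds]
  intro ε hε
  obtain ⟨δ, hδ, hδφ⟩ := Metric.continuous_iff.1 hφc h (ε / 4) (by positivity)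
  -- `δ` makes the two Gaussian limits close; the other bound gives `|t| ‖h - g‖ < ε / 4`, with `+
  -- 1` allowing `t = 0`.
  obtain ⟨g, hg, K, hgm, hgK, hg0, hgh⟩ := exists_bounded_adjoint_koopman_eq_zero hTm hh
    (ε := min δ (ε / (4 * (|t| + 1)))) (by positivity)
  set G : Lp ℝ 2 μ := hg.toLp g with hG
  have hφG : dist (φ G) (φ h) < ε / 4 :=
    hδφ G (by rw [dist_comm, dist_eq_norm]; exact hgh.trans_le (min_le_left _ _))
  have hclt := hT.tendsto_integral_exp_of_bounded hgm hgK (fun u hu ⟨C, hC⟩ =>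
    integral_mul_comp_eq_zero_of_adjoint_koopman_eq_zero hTm hg hg0 hu hC) t
  have hGn : ∫ x, g x ^ 2 ∂μ = ‖G‖ ^ 2 := by
    rw [← real_inner_self_eq_norm_sq, L2.inner_def]
    refine integral_congr_ae ?_
    filter_upwards [hg.coeFn_toLp] with x hx
    rw [hx]
    simp [sq]
  rw [hGn] at hclt
  have hJG : ∀ n : ℕ, ∫ x, Complex.exp
      (Complex.I * ((t * ((∑ k ∈ Finset.range n, g (T^[k] x)) / √n) : ℝ) : ℂ)) ∂μ = J (A n G) := by
    intro n
    refine integral_congr_ae ?_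
    filter_upwards [coeFn_sum_koopman_pow_toLp hTm hg n,
      Lp.coeFn_smul (√(n : ℝ))⁻¹ (∑ k ∈ Finset.range n, (U ^ k) G)] with x h1 h2
    rw [h2, Pi.smul_apply, h1, smul_eq_mul, div_eq_inv_mul]
  simp only [hJG] at hclt
  have hclt' := (Metric.tendsto_nhds.1 hclt) (ε / 4) (by positivity)
  have hw : Tendsto (fun n : ℕ => |t| * (2 * ‖w‖) / √n) atTop (𝓝 0) :=
    tendsto_const_nhds.div_atTop (Real.tendsto_sqrt_atTop.comp tendsto_natCast_atTop_atTop)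
  filter_upwards [hclt', hw.eventually_lt_const (by positivity : 0 < ε / 4),
    eventually_gt_atTop 0] with n h1 h2 hn
  have hr : 0 < √(n : ℝ) := Real.sqrt_pos.2 (by exact_mod_cast hn)
  have h3 : dist (J (A n F)) (J (A n h)) ≤ |t| * (2 * ‖w‖) / √n := by
    rw [dist_eq_norm]
    refine (norm_integral_exp_sub_integral_exp_le t _ _).trans ?_
    rw [← smul_sub, norm_smul, norm_inv, Real.norm_of_nonneg hr.le, mul_div_assoc,
      ← div_eq_inv_mul]
    gcongr
    exact norm_sum_pow_apply_sub_le hUn hF n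
  -- Uniform in `n`: `h - G` also lies in the kernel, so its orbit sum has norm exactly `√n ‖h -
  -- G‖`.
  have h4 : dist (J (A n h)) (J (A n G)) < ε / 4 := by
    rw [dist_eq_norm]
    refine (norm_integral_exp_sub_integral_exp_le t _ _).trans_lt ?_
    have e : ∑ k ∈ Finset.range n, (U ^ k) h - ∑ k ∈ Finset.range n, (U ^ k) G
        = ∑ k ∈ Finset.range n, (U ^ k) (h - G) := by
      rw [← Finset.sum_sub_distrib]
      simp only [map_sub]
    rw [← smul_sub, norm_smul, norm_inv, Real.norm_of_nonneg hr.le, e,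
      norm_sum_pow_apply hUn (by rw [map_sub, hh, hg0, sub_self]), inv_mul_cancel_left₀ hr.ne']
    have h5 := hgh.trans_le (min_le_right _ _)
    rw [lt_div_iff₀ (by positivity)] at h5
    nlinarith [norm_nonneg (h - G), abs_nonneg t]
  calc dist (J (A n F)) (φ h)
      ≤ dist (J (A n F)) (J (A n h)) + dist (J (A n h)) (J (A n G))
        + dist (J (A n G)) (φ G) + dist (φ G) (φ h) :=
        (dist_triangle _ (φ G) _).trans (add_le_add_left (dist_triangle4 _ _ _ _) _)
    _ < ε := by linarith

end SquareIntegrableCLT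

/-! ### The doubling map and independence of binary digits -/

section UnitCircle

instance : IsProbabilityMeasure unitLebesgue := ⟨by simp [unitLebesgue]⟩

instance : IsProbabilityMeasure (volume : Measure UnitAddCircle) := ⟨UnitAddCircle.measure_univ⟩

theorem unitLebesgue_eq_restrict_Ioc : unitLebesgue = volume.restrict (Ioc (0 : ℝ) (0 + 1)) := by
  rw [zero_add]
  exact Measure.restrict_congr_set Ioc_ae_eq_Icc.symm

theorem measurePreserving_coe_unitLebesgue :
    MeasurePreserving ((↑) : ℝ → UnitAddCircle) unitLebesgue volume := by
  rw [unitLebesgue_eq_restrict_Ioc]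
  exact AddCircle.measurePreserving_mk 1 0

theorem Function.Periodic.memLp_lift {f : ℝ → ℝ} (hper : Function.Periodic f 1)
    (hf : MemLp f 2 unitLebesgue) :
    MemLp (hper.lift : UnitAddCircle → ℝ) 2 volume := by
  have h1 : MeasurePreserving (fun y : UnitAddCircle => ((AddCircle.equivIoc 1 0 y : ℝ)))
      volume unitLebesgue := by
    rw [unitLebesgue_eq_restrict_Ioc]
    exact (measurePreserving_subtype_coe measurableSet_Ioc).comp
      (AddCircle.measurePreserving_equivIoc 1)
  have h2 := hf.comp_measurePreserving h1
  convert h2 using 1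
  funext y
  have h3 : (((AddCircle.equivIoc 1 0 y : ℝ)) : UnitAddCircle) = y :=
    (AddCircle.equivIoc 1 0).symm_apply_apply y
  conv_lhs => rw [← h3]
  exact hper.lift_coe _

/-- The doubling map of the circle. -/
abbrev circleDouble : UnitAddCircle → UnitAddCircle := fun y => 2 • y

theorem ergodic_circleDouble : Ergodic circleDouble volume :=
  AddCircle.ergodic_nsmul one_lt_two

theorem circleDouble_iterate_coe (k : ℕ) (x : ℝ) :
    circleDouble^[k] (x : UnitAddCircle) = ((2 ^ k * x : ℝ) : UnitAddCircle) := by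
  induction k with
  | zero => simp
  | succ k ih =>
    rw [Function.iterate_succ_apply', ih]
    simp only [circleDouble]
    rw [← AddCircle.coe_nsmul]
    congr 1
    rw [nsmul_eq_mul, pow_succ']
    push_cast
    ring

theorem measurePreserving_coe_two_pow_mul (k : ℕ) :
    MeasurePreserving (fun x : ℝ => ((2 ^ k * x : ℝ) : UnitAddCircle)) unitLebesgue volume := by
  have := (ergodic_circleDouble.toMeasurePreserving.iterate k).comp
    measurePreserving_coe_unitLebesgue
  convert this using 1
  funext x
  exact (circleDouble_iterate_coe k x).symm

/-- The digits up to place `k` are independent of the later ones. -/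
theorem indep_dyadicSigma_comap (k : ℕ) :
    ProbabilityTheory.Indep (dyadicSigma k)
      (MeasurableSpace.comap (fun x : ℝ => ((2 ^ k * x : ℝ) : UnitAddCircle)) inferInstance)
      unitLebesgue := by
  have hq := measurePreserving_coe_two_pow_mul k
  have h2k : (0 : ℝ) < 2 ^ k := by positivity
  -- On each dyadic cell of level `k`, `x ↦ 2 ^ k * x` covers the circle exactly once, scaling
  -- measure by `2 ^ k`.
  have hvol : ∀ (j : ℕ) (A : Set UnitAddCircle), j < 2 ^ k → MeasurableSet A →
      unitLebesgue (Ioc ((j : ℝ) / 2 ^ k) (((j : ℝ) + 1) / 2 ^ k) ∩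
        (fun x : ℝ => ((2 ^ k * x : ℝ) : UnitAddCircle)) ⁻¹' A) =
      ENNReal.ofReal |(2 ^ k : ℝ)⁻¹| * volume A := by
    intro j A hj hA
    have hj' : (j : ℝ) + 1 ≤ 2 ^ k := by exact_mod_cast hj
    have hsub : Ioc ((j : ℝ) / 2 ^ k) (((j : ℝ) + 1) / 2 ^ k) ⊆ Icc 0 1 := fun x hx =>
      ⟨(by positivity : (0 : ℝ) ≤ j / 2 ^ k).trans hx.1.le,
        hx.2.trans ((div_le_one h2k).2 hj')⟩
    have hset : Ioc ((j : ℝ) / 2 ^ k) (((j : ℝ) + 1) / 2 ^ k) ∩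
        (fun x : ℝ => ((2 ^ k * x : ℝ) : UnitAddCircle)) ⁻¹' A =
        (2 ^ k * ·) ⁻¹' (((↑) : ℝ → UnitAddCircle) ⁻¹' A ∩ Ioc (j : ℝ) (j + 1)) := by
      ext x
      simp only [mem_inter_iff, mem_Ioc, mem_preimage, div_lt_iff₀ h2k, le_div_iff₀ h2k,
        mul_comm x]
      tauto
    rw [Measure.restrict_apply' measurableSet_Icc, inter_eq_left.2 (inter_subset_left.trans hsub),
      hset, Real.volume_preimage_mul_left h2k.ne']
    congr 1
    have hmk := AddCircle.measurePreserving_mk 1 (j : ℝ)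
    rw [← hmk.measure_preimage hA.nullMeasurableSet, Measure.restrict_apply' measurableSet_Ioc]
  refine ProbabilityTheory.IndepSets.indep (dyadicSigma_le k) hq.measurable.comap_le ?_
    (@MeasurableSpace.isPiSystem_measurableSet _ (MeasurableSpace.comap _ inferInstance)) rfl
    (@MeasurableSpace.generateFrom_measurableSet _ (MeasurableSpace.comap _ inferInstance)).symm ?_
  · rintro _ ⟨i, hi, rfl⟩ _ ⟨j, hj, rfl⟩ ⟨x, hx1, hx2⟩
    rw [mem_Ioc, div_lt_iff₀ h2k, le_div_iff₀ h2k] at hx1 hx2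
    have h1 : (i : ℝ) < j + 1 := hx1.1.trans_le hx2.2
    have h2 : (j : ℝ) < i + 1 := hx2.1.trans_le hx1.2
    have h1' : i < j + 1 := by exact_mod_cast h1
    have h2' : j < i + 1 := by exact_mod_cast h2
    obtain rfl : i = j := by omega
    exact ⟨i, hi, inter_self _⟩
  · rw [ProbabilityTheory.IndepSets_iff]
    rintro _ _ ⟨j, hj, rfl⟩ ⟨A, hA, rfl⟩
    rw [hvol j A hj hA, hq.measure_preimage hA.nullMeasurableSet]
    congr 1
    have := hvol j univ hj MeasurableSet.univ
    rw [preimage_univ, inter_univ] at this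
    rw [this]
    simp

end UnitCircle

/-! ### Dyadic remainders, decomposition and convergence in law -/

section DyadicCLT

open ContinuousLinearMap

/-- Independence kills the pairing of `U^k G` with `f_k`, leaving `‖G‖² = ⟨U^k G, φ_k⟩ ≤ ‖G‖ ‖φ_k‖`.
-/
theorem norm_adjoint_koopman_circleDouble_pow_le {f : ℝ → ℝ} (hper : Function.Periodic f 1)
    (hf : MemLp f 2 unitLebesgue) (h0 : ∫ x, f x ∂unitLebesgue = 0) (k : ℕ) :
    ‖(adjoint (koopman ergodic_circleDouble.toMeasurePreserving) ^ k)
        ((hper.memLp_lift hf).toLp _)‖ ≤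
      (eLpNorm (dyadicRemainder f k) 2 unitLebesgue).toReal := by
  have hT := ergodic_circleDouble.toMeasurePreserving
  set F := (hper.memLp_lift hf).toLp _ with hF
  set U := koopman hT with hU
  set G := (adjoint U ^ k) F with hG
  set q : ℝ → UnitAddCircle := fun x => ((2 ^ k * x : ℝ) : UnitAddCircle) with hqdef
  have hq : MeasurePreserving q unitLebesgue volume := measurePreserving_coe_two_pow_mul k
  have hu : MemLp (fun x => G (q x)) 2 unitLebesgue :=
    (Lp.memLp G).comp_measurePreserving hq
  have hun : ‖hu.toLp‖ = ‖G‖ := by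
    rw [Lp.norm_toLp, Lp.norm_def]
    congr 1
    exact eLpNorm_comp_measurePreserving (Lp.aestronglyMeasurable G) hq
  have hfk : MemLp (dyadicCondExp f k) 2 unitLebesgue :=
    MemLp.condExp one_le_two hf
  have hφ : MemLp (dyadicRemainder f k) 2 unitLebesgue := hf.sub hfk
  have hadj : ∀ (n : ℕ) (a b : Lp ℝ 2 (volume : Measure UnitAddCircle)),
      inner ℝ a ((adjoint U ^ n) b) = inner ℝ ((U ^ n) a) b := by
    intro n
    induction n with
    | zero => simp
    | succ n ih =>
      intro a b
      rw [pow_succ', mul_apply_eq_comp, adjoint_inner_right, ih, pow_succ, mul_apply_eq_comp]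
  have h1 : ‖G‖ ^ 2 = ∫ x, G (q x) * f x ∂unitLebesgue := by
    rw [← real_inner_self_eq_norm_sq]
    conv_lhs => rw [hG, ← hG, hadj, L2.inner_def]
    rw [← measurePreserving_coe_unitLebesgue.integral_comp_of_aestronglyMeasurable
      (L2.integrable_inner (𝕜 := ℝ) _ _).aestronglyMeasurable]
    refine integral_congr_ae ?_
    have hqm := measurePreserving_coe_unitLebesgue.quasiMeasurePreserving
    filter_upwards [hqm.ae_eq_comp (coeFn_koopman_pow hT G k),
      hqm.ae_eq_comp (hper.memLp_lift hf).coeFn_toLp] with x h2 h3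
    simp only [Function.comp_apply] at h2 h3
    rw [← hU] at h2
    rw [← hF] at h3
    rw [h2, h3, circleDouble_iterate_coe, Function.Periodic.lift_coe]
    simp [hqdef, mul_comm]
  have h2 : ∫ x, dyadicCondExp f k x * G (q x) ∂unitLebesgue = 0 := by
    have hind : ProbabilityTheory.IndepFun (dyadicCondExp f k) q unitLebesgue := by
      rw [ProbabilityTheory.IndepFun_iff_Indep]
      exact ProbabilityTheory.indep_of_indep_of_le_left (indep_dyadicSigma_comap k)
        stronglyMeasurable_condExp.measurable.comap_le
    have hind2 : ProbabilityTheory.IndepFun (dyadicCondExp f k) (fun x => G (q x)) unitLebesgue :=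
      hind.comp measurable_id (Lp.stronglyMeasurable G).measurable
    rw [hind2.integral_fun_mul_eq_mul_integral hfk.aestronglyMeasurable hu.aestronglyMeasurable]
    have : ∫ x, dyadicCondExp f k x ∂unitLebesgue = 0 := by
      rw [← h0]
      exact integral_condExp (dyadicSigma_le k)
    rw [this, zero_mul]
  have h3 : ‖G‖ ^ 2 = inner ℝ hu.toLp (hφ.toLp _) := by
    have hi : Integrable (fun x => dyadicCondExp f k x * G (q x)) unitLebesgue :=
      hfk.integrable_mul hu
    have hi2 : Integrable (fun x => G (q x) * f x) unitLebesgue := hu.integrable_mul hf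
    rw [L2.inner_def, h1, ← sub_zero (∫ x, G (q x) * f x ∂unitLebesgue), ← h2,
      ← integral_sub hi2 hi]
    refine integral_congr_ae ?_
    filter_upwards [hu.coeFn_toLp, hφ.coeFn_toLp] with x h4 h5
    rw [h4, h5]
    simp only [dyadicRemainder, RCLike.inner_apply, conj_trivial]
    ring
  have h4 : ‖G‖ ^ 2 ≤ ‖G‖ * ‖hφ.toLp _‖ := by
    rw [h3, ← hun]
    exact real_inner_le_norm _ _
  rw [← Lp.norm_toLp _ hφ]
  rcases (norm_nonneg G).eq_or_lt with h5 | h5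
  · rw [← h5]
    exact norm_nonneg _
  · nlinarith

variable {f : ℝ → ℝ}

/-- The normalized sums as functions on the circle. -/
noncomputable def circleNormalizedSum (hper : Function.Periodic f 1) (n : ℕ) : UnitAddCircle → ℝ :=
  fun y => (∑ k ∈ Finset.range n, hper.lift (circleDouble^[k] y)) / √n

theorem circleNormalizedSum_coe (hper : Function.Periodic f 1) (n : ℕ) (x : ℝ) :
    circleNormalizedSum hper n (x : UnitAddCircle) = normalizedSum f n x := by
  simp only [circleNormalizedSum, normalizedSum, circleDouble_iterate_coe,
    Function.Periodic.lift_coe]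

theorem circleNormalizedSum_ae_eq (hper : Function.Periodic f 1) (hf : MemLp f 2 unitLebesgue)
    (n : ℕ) :
    ⇑((√(n : ℝ))⁻¹ • ∑ k ∈ Finset.range n,
        (koopman ergodic_circleDouble.toMeasurePreserving ^ k)
          ((hper.memLp_lift hf).toLp _) : Lp ℝ 2 (volume : Measure UnitAddCircle))
      =ᵐ[volume] circleNormalizedSum hper n := by
  filter_upwards [Lp.coeFn_smul (√(n : ℝ))⁻¹ (∑ k ∈ Finset.range n,
        (koopman ergodic_circleDouble.toMeasurePreserving ^ k) ((hper.memLp_lift hf).toLp _)),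
    coeFn_sum_koopman_pow_toLp ergodic_circleDouble.toMeasurePreserving (hper.memLp_lift hf) n]
    with y h1 h2
  rw [h1, Pi.smul_apply, h2, circleNormalizedSum, smul_eq_mul, div_eq_inv_mul]

theorem aestronglyMeasurable_circleNormalizedSum (hper : Function.Periodic f 1)
    (hf : MemLp f 2 unitLebesgue) (n : ℕ) :
    AEStronglyMeasurable (circleNormalizedSum hper n) volume :=
  (Lp.aestronglyMeasurable _).congr (circleNormalizedSum_ae_eq hper hf n)

theorem normalizedSqNorm_eq (hper : Function.Periodic f 1) (hf : MemLp f 2 unitLebesgue)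
    (n : ℕ) :
    normalizedSqNorm f n = (‖∑ k ∈ Finset.range n,
      (koopman ergodic_circleDouble.toMeasurePreserving ^ k)
        ((hper.memLp_lift hf).toLp _)‖ / √n) ^ 2 := by
  have h1 : normalizedSum f n = circleNormalizedSum hper n ∘ ((↑) : ℝ → UnitAddCircle) :=
    funext fun x => (circleNormalizedSum_coe hper n x).symm
  rw [normalizedSqNorm, h1, eLpNorm_comp_measurePreserving
    (aestronglyMeasurable_circleNormalizedSum hper hf n) measurePreserving_coe_unitLebesgue,
    ← eLpNorm_congr_ae (circleNormalizedSum_ae_eq hper hf n), ← Lp.norm_def, norm_smul,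
    norm_inv, Real.norm_of_nonneg (Real.sqrt_nonneg _), div_eq_inv_mul]

theorem exists_decomposition_of_tsum_lt_top (hper : Function.Periodic f 1)
    (hf : MemLp f 2 unitLebesgue)
    (hsum : ∑' s : ℕ, eLpNorm (dyadicRemainder f (s + 1)) 2 unitLebesgue < ⊤)
    (h0 : ∫ x, f x ∂unitLebesgue = 0) :
    ∃ h w : Lp ℝ 2 (volume : Measure UnitAddCircle),
      adjoint (koopman ergodic_circleDouble.toMeasurePreserving) h = 0 ∧
      (hper.memLp_lift hf).toLp _ =
        h + (koopman ergodic_circleDouble.toMeasurePreserving w - w) := by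
  refine exists_eq_add_sub_of_summable_adjoint_pow (norm_koopman _) ?_
  -- The hypothesis starts at `s = 1`; the term `k = 0` does not affect summability.
  rw [← summable_nat_add_iff 1]
  exact (ENNReal.summable_toReal hsum.ne).of_nonneg_of_le (fun _ => norm_nonneg _)
    fun s => norm_adjoint_koopman_circleDouble_pow_le hper hf h0 (s + 1)

/-- A mean `m` contributes `n m` to the integral of the sum, so `m²` is at most the normalized
squared norm over `n`, which tends to zero. -/
theorem integral_eq_zero_of_tendsto_normalizedSqNorm (hper : Function.Periodic f 1)
    (hf : MemLp f 2 unitLebesgue) {v : ℝ}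
    (hv : Tendsto (fun n : ℕ => normalizedSqNorm f n) atTop (𝓝 v)) :
    ∫ x, f x ∂unitLebesgue = 0 := by
  set F := (hper.memLp_lift hf).toLp _ with hF
  have hT := ergodic_circleDouble.toMeasurePreserving
  have hm : ∫ x, f x ∂unitLebesgue = ∫ y, F y := by
    rw [integral_congr_ae (hper.memLp_lift hf).coeFn_toLp,
      ← measurePreserving_coe_unitLebesgue.integral_comp_of_aestronglyMeasurable
        (hper.memLp_lift hf).aestronglyMeasurable]
    simp only [Function.Periodic.lift_coe]
  set m := ∫ y, F y with hmdef
  have hbound : ∀ n : ℕ, 0 < n → m ^ 2 ≤ normalizedSqNorm f n / n := by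
    intro n hn
    have hn' : (0 : ℝ) < n := by exact_mod_cast hn
    set S := ∑ k ∈ Finset.range n, (koopman hT ^ k) F with hS
    have h1 : inner ℝ (Lp.const 2 volume (1 : ℝ)) S = n * m := by
      rw [hS, inner_sum]
      simp only [inner_const_one, integral_koopman_pow, ← hmdef]
      simp
    have h2 : |n * m| ≤ ‖S‖ := by
      rw [← h1, inner_const_one]
      exact abs_integral_le_integral_abs.trans (integral_abs_coeFn_le_norm S)
    have h3 := pow_le_pow_left₀ (abs_nonneg _) h2 2
    rw [sq_abs] at h3
    rw [normalizedSqNorm_eq hper hf, div_pow, Real.sq_sqrt hn'.le, div_div,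
      le_div_iff₀ (by positivity)]
    nlinarith
  have hlim : Tendsto (fun n : ℕ => normalizedSqNorm f n / n) atTop (𝓝 0) :=
    hv.div_atTop tendsto_natCast_atTop_atTop
  have h5 : m ^ 2 ≤ 0 :=
    ge_of_tendsto hlim ((eventually_gt_atTop 0).mono fun n hn => hbound n hn)
  rw [hm]
  exact pow_eq_zero_iff two_ne_zero |>.1 (le_antisymm h5 (sq_nonneg m))

theorem gaussianReal_zero_real_Iic {σ : ℝ} (hσ : 0 < σ) (t : ℝ) :
    (ProbabilityTheory.gaussianReal 0 (σ ^ 2).toNNReal (Iic t)).toReal =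
      1 / (σ * Real.sqrt (2 * Real.pi)) *
        ∫ u in Iic t, Real.exp (-u ^ 2 / (2 * σ ^ 2)) := by
  have hv : (σ ^ 2).toNNReal ≠ 0 := by
    rw [Ne, Real.toNNReal_eq_zero, not_le]
    positivity
  rw [ProbabilityTheory.gaussianReal_apply_eq_integral _ hv, ENNReal.toReal_ofReal
    (integral_nonneg fun _ => ProbabilityTheory.gaussianPDFReal_nonneg _ _ _),
    ← integral_const_mul]
  refine integral_congr_ae (Eventually.of_forall fun x => ?_)
  simp only [ProbabilityTheory.gaussianPDFReal, sub_zero, Real.coe_toNNReal _ (sq_nonneg σ)]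
  rw [Real.sqrt_mul (by positivity), Real.sqrt_sq hσ.le, mul_comm σ, one_div]

theorem tendsto_volume_normalizedSum_le (hper : Function.Periodic f 1)
    (hf : MemLp f 2 unitLebesgue) {h w : Lp ℝ 2 (volume : Measure UnitAddCircle)}
    (hh : adjoint (koopman ergodic_circleDouble.toMeasurePreserving) h = 0)
    (hF : (hper.memLp_lift hf).toLp _ =
      h + (koopman ergodic_circleDouble.toMeasurePreserving w - w)) (hpos : 0 < ‖h‖) (t : ℝ) :
    Tendsto (fun n : ℕ => (volume {x : ℝ | x ∈ Icc (0 : ℝ) 1 ∧ normalizedSum f n x ≤ t}).toReal)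
      atTop (𝓝 (ProbabilityTheory.gaussianReal 0 (‖h‖ ^ 2).toNNReal (Iic t)).toReal) := by
  have hm : ∀ n, AEMeasurable (circleNormalizedSum hper n) volume := fun n =>
    (aestronglyMeasurable_circleNormalizedSum hper hf n).aemeasurable
  set ν : ℕ → ProbabilityMeasure ℝ := fun n =>
    ⟨(volume : Measure UnitAddCircle).map (circleNormalizedSum hper n),
      Measure.isProbabilityMeasure_map (hm n)⟩ with hν
  set γ : ProbabilityMeasure ℝ :=
    ⟨ProbabilityTheory.gaussianReal 0 (‖h‖ ^ 2).toNNReal, inferInstance⟩ with hγ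
  have hlim : Tendsto ν atTop (𝓝 γ) := by
    rw [ProbabilityMeasure.tendsto_iff_tendsto_charFun]
    intro s
    have h1 := ergodic_circleDouble.tendsto_integral_exp_sum_koopman_pow hh hF s
    have h2 : charFun (γ : Measure ℝ) s = (Real.exp (-(s ^ 2 * ‖h‖ ^ 2 / 2)) : ℂ) := by
      simp only [hγ, ProbabilityMeasure.coe_mk, ProbabilityTheory.charFun_gaussianReal,
        Real.coe_toNNReal _ (sq_nonneg ‖h‖)]
      push_cast
      congr 1
      simp
      ring
    rw [h2]
    refine h1.congr fun n => ?_
    simp only [hν, ProbabilityMeasure.coe_mk, charFun_apply_real]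
    rw [integral_map (hm n) (by fun_prop)]
    refine integral_congr_ae ?_
    filter_upwards [circleNormalizedSum_ae_eq hper hf n] with y hy
    rw [hy]
    push_cast
    ring_nf
  have hv : (‖h‖ ^ 2).toNNReal ≠ 0 := by
    rw [Ne, Real.toNNReal_eq_zero, not_le]
    positivity
  -- Nonzero variance excludes atoms, so the frontier `{t}` of `Iic t` is null, as the portmanteau
  -- theorem requires.
  have hatom := ProbabilityTheory.nullSingletonClass_gaussianReal (μ := 0) hv
  have hport := ProbabilityMeasure.tendsto_measure_of_null_frontier_of_tendsto' hlim (E := Iic t)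
    (by rw [frontier_Iic]; exact hatom.measure_singleton t)
  refine ((ENNReal.tendsto_toReal (measure_ne_top _ _)).comp hport).congr fun n => ?_
  simp only [Function.comp_apply, hν, ProbabilityMeasure.coe_mk]
  congr 1
  rw [Measure.map_apply_of_aemeasurable (hm n) measurableSet_Iic,
    ← measurePreserving_coe_unitLebesgue.measure_preimage
      ((hm n).nullMeasurable measurableSet_Iic), Measure.restrict_apply' measurableSet_Icc]
  congr 1
  ext x
  simp only [mem_inter_iff, mem_preimage, mem_Iic, circleNormalizedSum_coe, mem_ofPred_eq]
  exact and_comm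

end DyadicCLT

theorem mainTheorem7 (f : ℝ → ℝ) (hper : Function.Periodic f 1)
    (hf : MemLp f 2 unitLebesgue)
    (hsum : ∑' s : ℕ, eLpNorm (dyadicRemainder f (s + 1)) 2 unitLebesgue < ⊤) :
    ((∫ x in Icc (0 : ℝ) 1, f x = 0) →
      ∃ v : ℝ, Tendsto (fun n : ℕ => normalizedSqNorm f n) atTop (𝓝 v)) ∧
    ∀ σ : ℝ, 0 < σ →
      Tendsto (fun n : ℕ => normalizedSqNorm f n) atTop (𝓝 (σ ^ 2)) →
      ∀ t : ℝ,
        Tendsto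
          (fun n : ℕ => (volume {x : ℝ | x ∈ Icc (0 : ℝ) 1 ∧ normalizedSum f n x ≤ t}).toReal)
          atTop
          (𝓝 (1 / (σ * Real.sqrt (2 * Real.pi)) *
            ∫ u in Iic t, Real.exp (-u ^ 2 / (2 * σ ^ 2)))) := by
  -- This gives the limit in (i) and, by uniqueness of limits, `σ = ‖h‖` in (ii).
  have key : ∀ {h w : Lp ℝ 2 (volume : Measure UnitAddCircle)},
      ContinuousLinearMap.adjoint (koopman ergodic_circleDouble.toMeasurePreserving) h = 0 →
      (hper.memLp_lift hf).toLp _ =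
        h + (koopman ergodic_circleDouble.toMeasurePreserving w - w) →
      Tendsto (fun n : ℕ => normalizedSqNorm f n) atTop (𝓝 (‖h‖ ^ 2)) := by
    intro h w hh hF
    simp only [normalizedSqNorm_eq hper hf]
    exact (tendsto_norm_sum_pow_apply_div_sqrt (norm_koopman _) hh hF).pow 2
  refine ⟨fun h0 => ?_, fun σ hσ hlim t => ?_⟩
  · obtain ⟨h, w, hh, hF⟩ := exists_decomposition_of_tsum_lt_top hper hf hsum h0
    exact ⟨_, key hh hF⟩
  · obtain ⟨h, w, hh, hF⟩ := exists_decomposition_of_tsum_lt_top hper hf hsum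
      (integral_eq_zero_of_tendsto_normalizedSqNorm hper hf hlim)
    have hσh : ‖h‖ = σ :=
      (pow_left_inj₀ (norm_nonneg h) hσ.le two_ne_zero).1 (tendsto_nhds_unique (key hh hF) hlim)
    rw [← gaussianReal_zero_real_Iic hσ, ← hσh]
    exact tendsto_volume_normalizedSum_le hper hf hh hF (by rwa [hσh]) t
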